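/- **Proposition 5.1.** Let $X,Y,Z^{(1)},\dots,Z^{(p)}$ be square integrable real random variables on a probability space such that $\mathbf 1,X,Y,Z^{(1)},\dots,Z^{(p)}$ are linearly independent in $\mathbb L^2$. Let $X(\mathbf Z)=X-\mathrm{Proj}_{V(\mathbf Z)}(X)$ and $Y(\mathbf Z)=Y-\mathrm{Proj}_{V(\mathbf Z)}(Y)$, where $\mathrm{Proj}_{V(\mathbf Z)}$ is the orthogonal projection in $\mathbb L^2$ onto the span $V(\mathbf Z)$ of $\mathbf 1,Z^{(1)},\dots,Z^{(p)}$. Write $$Y(\mathbf Z)=\alpha_0+\alpha X(\mathbf Z)+\varepsilon^{(1)},\qquad X(\mathbf Z)=\theta_0+\theta Y(\mathbf Z)+\varepsilon^{(2)},$$ with $\varepsilon^{(1)}$ orthogonal to $\mathbf 1,X(\mathbf Z)$ and $\varepsilon^{(2)}$ orthogonal to $\mathbf 1,Y(\mathbf Z)$ in $\mathbb L^2$. The squared partial correlation is $$R^2(X(\mathbf Z),Y(\mathbf Z))=\frac{\mathrm{Var}(\alpha_0+\alpha X(\mathbf Z))}{\mathrm{Var}(Y(\mathbf Z))}.$$ Let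 $(X_i,Y_i,\mathbf Z_i)_{i\ge1}$ be independent copies of $(X,Y,\mathbf Z)$, where $\mathbf Z=(Z^{(1)},\dots,Z^{(p)})$. For each $n$, let $\hat a=(D^tD)^{-1}D^t(X_1,\dots,X_n)^t$ and $\hat b=(D^tD)^{-1}D^t(Y_1,\dots,Y_n)^t$ in $\mathbb R^{p+1}$ be the least squares estimators, where $D$ is the $n\times(p+1)$ matrix with rows $(1,Z^{(1)}_i,\dots,Z^{(p)}_i)$. Let $\hat x_i=X_i-\hat a_0-\hat a_1Z_i^{(1)}-\cdots-\hat a_pZ_i^{(p)}$ and $\hat y_i=Y_i-\hat b_0-\hat b_1Z_i^{(1)}-\cdots-\hat b_pZ_i^{(p)}$ be the residuals, and let $$\widehat R^2(X(\mathbf Z),Y(\mathbf Z))=\hat\alpha\,\hat\theta,\qquad \hat\alpha=\frac{\sum_{i=1}^n\hat x_i\hat y_i}{\sum_{i=1}^n\hat x_i^2},\qquad \hat\theta=\frac{\sum_{i=1}^n\hat x_i\hat y_i}{\sum_{i=1}^n\hat y_i^2}.$$ (When $D^tD$ is singular or a denominator vanishes, the inverse or the quotient is read as $0$.) Assume that $\mathbb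 E\big((Z^{(j)})^2X(\mathbf Z)^2\big)<\infty$ and $\mathbb E\big((Z^{(j)})^2Y(\mathbf Z)^2\big)<\infty$ for every $j\in\{1,\dots,p\}$, and that $\mathbb E\big(X(\mathbf Z)^2(\varepsilon^{(1)})^2\big)<\infty$ and $\mathbb E\big(Y(\mathbf Z)^2(\varepsilon^{(2)})^2\big)<\infty$. Let $A$ and $B$ be the symmetric $2\times2$ matrices with $$A_{1,1}=\mathbb E\big(X(\mathbf Z)^2(\varepsilon^{(1)})^2\big),\quad A_{2,2}=\mathbb E\big(Y(\mathbf Z)^2(\varepsilon^{(2)})^2\big),\quad A_{1,2}=\mathbb E\big(X(\mathbf Z)Y(\mathbf Z)\varepsilon^{(1)}\varepsilon^{(2)}\big),$$ $$B_{1,1}=\mathrm{Var}(X(\mathbf Z))^{-1},\quad B_{2,2}=\mathrm{Var}(Y(\mathbf Z))^{-1},\quad B_{1,2}=0.$$ Then $X(\mathbf Z)Y(\mathbf Z)\varepsilon^{(1)}\varepsilon^{(2)}$ is integrable, $V:=(\theta,\alpha)\,BAB\,(\theta,\alpha)^t\ge0$, and, as $n\to\infty$, $$\sqrt n\left(\widehat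 R^2(X(\mathbf Z),Y(\mathbf Z))-R^2(X(\mathbf Z),Y(\mathbf Z))\right)\ \xrightarrow{\ \mathcal L\ }\ \mathcal N(0,V).$$ -/

import Mathlib

open MeasureTheory ProbabilityTheory Filter Topology
open scoped ENNReal

namespace PartialCorr

noncomputable section Population

variable {Ω : Type*} [MeasurableSpace Ω] {μ : Measure Ω} [IsProbabilityMeasure μ]

/-- The constant random variable `1`, as an element of `L²(μ)`. -/
def one (μ : Measure Ω) [IsProbabilityMeasure μ] : Lp ℝ 2 μ := Lp.const 2 μ (1 : ℝ)

/-- The family `1, F 0, …, F (k-1)` in `L²(μ)`. -/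
def withOne {k : ℕ} (F : Fin k → Lp ℝ 2 μ) : Fin (k + 1) → Lp ℝ 2 μ :=
  Fin.cons (one μ) F

instance instHasOrthogonalProjectionSpanRange {k : ℕ} (F : Fin k → Lp ℝ 2 μ) :
    (Submodule.span ℝ (Set.range F)).HasOrthogonalProjection :=
  haveI := FiniteDimensional.span_of_finite ℝ (Set.finite_range F)
  inferInstance

/-- The orthogonal projection, in `L²(μ)`, of `W` onto the linear span of `1, F 0, …, F (k-1)`. -/
def proj {k : ℕ} (F : Fin k → Lp ℝ 2 μ) (W : Lp ℝ 2 μ) : Lp ℝ 2 μ :=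
  (Submodule.span ℝ (Set.range (withOne F))).starProjection W

/-- `W` minus its orthogonal projection onto the linear span of `1, F 0, …, F (k-1)`. -/
def resid {k : ℕ} (F : Fin k → Lp ℝ 2 μ) (W : Lp ℝ 2 μ) : Lp ℝ 2 μ :=
  W - proj F W

theorem exists_coef {k : ℕ} (F : Fin k → Lp ℝ 2 μ) (W : Lp ℝ 2 μ) :
    ∃ c : Fin (k + 1) → ℝ, ∑ j, c j • withOne F j = proj F W :=
  (Submodule.mem_span_range_iff_exists_fun ℝ).1
    (Submodule.starProjection_apply_mem (Submodule.span ℝ (Set.range (withOne F))) W)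

/-- Coefficients of the orthogonal projection of `W` in the family `1, F 0, …, F (k-1)`
(the coefficient of index `0` is the intercept). They are unique when this family is linearly
independent. -/
def coef {k : ℕ} (F : Fin k → Lp ℝ 2 μ) (W : Lp ℝ 2 μ) : Fin (k + 1) → ℝ :=
  (exists_coef F W).choose

theorem coef_spec {k : ℕ} (F : Fin k → Lp ℝ 2 μ) (W : Lp ℝ 2 μ) :
    ∑ j, coef F W j • withOne F j = proj F W :=
  (exists_coef F W).choose_spec

/-- The slope of the linear regression (with intercept) of `W` on the single variable `U`:
`W = c₀ + regSlope U W • U + ε` with `ε` orthogonal to `1` and to `U`. -/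
def regSlope (U W : Lp ℝ 2 μ) : ℝ := coef ![U] W 1

/-- The `R²` coefficient between `U` and `W`: the part of the variance of `W` that is explained
by the best linear predictor based on `1` and `U`. -/
def R2 (U W : Lp ℝ 2 μ) : ℝ :=
  variance (proj ![U] W : Lp ℝ 2 μ) μ / variance W μ

/-- The matrix `A`, for the variables `x = X(Z)` and `y = Y(Z)`: here `ε₁ = resid ![x] y` and
`ε₂ = resid ![y] x` are the errors in the regressions of `y` on `x` and of `x` on `y`. -/
def matA (x y : Lp ℝ 2 μ) : Matrix (Fin 2) (Fin 2) ℝ :=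
  let ε₁ := resid ![x] y
  let ε₂ := resid ![y] x
  !![∫ ω, x ω ^ 2 * ε₁ ω ^ 2 ∂μ, ∫ ω, x ω * y ω * ε₁ ω * ε₂ ω ∂μ;
     ∫ ω, x ω * y ω * ε₁ ω * ε₂ ω ∂μ, ∫ ω, y ω ^ 2 * ε₂ ω ^ 2 ∂μ]

/-- The matrix `B`. -/
def matB (x y : Lp ℝ 2 μ) : Matrix (Fin 2) (Fin 2) ℝ :=
  !![(variance x μ)⁻¹, 0; 0, (variance y μ)⁻¹]

/-- The limiting variance `(θ, α) B A B (θ, α)ᵗ`, where `α` is the slope of the regression of `y`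
on `x`, and `θ` is the slope of the regression of `x` on `y`. -/
def limitVar (x y : Lp ℝ 2 μ) : ℝ :=
  let α := regSlope x y
  let θ := regSlope y x
  ![θ, α] ⬝ᵥ ((matB x y * matA x y * matB x y).mulVec ![θ, α])

end Population

noncomputable section Sample

/-- The design matrix with rows `(1, z i 0, …, z i (p-1))`. -/
def design {n p : ℕ} (z : Fin n → Fin p → ℝ) : Matrix (Fin n) (Fin (p + 1)) ℝ :=
  Matrix.of fun i => Fin.cons 1 (z i)

/-- The least squares estimator `(DᵗD)⁻¹ Dᵗ w`, where `D` is the design matrix. -/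
def lsCoef {n p : ℕ} (z : Fin n → Fin p → ℝ) (w : Fin n → ℝ) : Fin (p + 1) → ℝ :=
  ((design z).transpose * design z)⁻¹.mulVec ((design z).transpose.mulVec w)

/-- The empirical residuals `w i - ĉ 0 - ĉ 1 * z i 0 - … - ĉ p * z i (p-1)`. -/
def lsResid {n p : ℕ} (z : Fin n → Fin p → ℝ) (w : Fin n → ℝ) : Fin n → ℝ :=
  fun i => w i - ∑ j, lsCoef z w j * design z i j

/-- The estimator `α̂` computed from the data `(x i, y i, z i)`, `i < n`. -/
def alphaHat {n p : ℕ} (x y : Fin n → ℝ) (z : Fin n → Fin p → ℝ) : ℝ :=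
  (∑ i, lsResid z x i * lsResid z y i) / ∑ i, lsResid z x i ^ 2

/-- The estimator `θ̂` computed from the data `(x i, y i, z i)`, `i < n`. -/
def thetaHat {n p : ℕ} (x y : Fin n → ℝ) (z : Fin n → Fin p → ℝ) : ℝ :=
  (∑ i, lsResid z x i * lsResid z y i) / ∑ i, lsResid z y i ^ 2

/-- The empirical squared partial correlation `α̂ θ̂`. -/
def R2Hat {n p : ℕ} (x y : Fin n → ℝ) (z : Fin n → Fin p → ℝ) : ℝ :=
  alphaHat x y z * thetaHat x y z

end Sample

end PartialCorr

/-! Write x = X(Z), y = Y(Z), and let a, b, c be the sums of x̂ᵢ², ŷᵢ², x̂ᵢŷᵢ, so that R̂² =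
c²/(ab), while R² = αθ.

Least squares residuals do not change when a linear combination of the regressors is added to the
data, so X, Y may be replaced by x, y. The sums of residual products then differ from the sums of
xᵢ², yᵢ², xᵢyᵢ by (Dᵗw)ᵗ(DᵗD)⁻¹(Dᵗv). Since DᵗD/n has an invertible limit and the entries of Dᵗx,
Dᵗy are sums of centered square integrable variables, this correction is o(√n) in probability
(`tendsto_fittedForm_div_sqrt`).

With V₁ = c − αa and V₂ = c − θb one has the exact identity c² − αθab = c(V₁ + V₂) − V₁V₂. Up to
o(√n), V₁ and V₂ are the sums of xε⁽¹⁾ and yε⁽²⁾. The product V₁V₂ is negligible and nc/(ab) tends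
to κ = 𝔼(xy)/(𝔼(x²)𝔼(y²)) (`tendsto_R2Hat_expansion`). The central limit theorem and Slutsky's
theorem give the limit N(0, κ²𝔼(xε⁽¹⁾ + yε⁽²⁾)²), and B(θ, α)ᵗ = κ(1, 1)ᵗ identifies this variance
with V (`limitVar_eq`).

The expansion is deterministic, along any filter on which the averages converge and the normalized
sums vanish. Subsequences turn it into convergence in probability
(`tendstoInMeasure_zero_of_ae_imp`). -/

namespace PartialCorr

/-- The vector `(1, z 0, …, z (p-1))`. -/
def consOne {p : ℕ} (z : Fin p → ℝ) : Fin (p + 1) → ℝ := Fin.cons 1 z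

theorem measurable_consOne_apply {p : ℕ} (j : Fin (p + 1)) :
    Measurable fun z : Fin p → ℝ => consOne z j := by
  refine Fin.cases ?_ (fun j => ?_) j
  · simp [consOne]
  · simp only [consOne, Fin.cons_succ]
    fun_prop

/-! ### Finite-sample least squares: algebra and measurability. -/

section LeastSquares

variable {n p : ℕ}

/-- The Gram matrix `DᵗD` of the design matrix. -/
noncomputable def designGram (z : Fin n → Fin p → ℝ) : Matrix (Fin (p + 1)) (Fin (p + 1)) ℝ :=
  (design z).transpose * design z

/-- The vector `Dᵗ w`. -/
noncomputable def designMoment (z : Fin n → Fin p → ℝ) (w : Fin n → ℝ) : Fin (p + 1) → ℝ :=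
  (design z).transpose.mulVec w

/-- The bilinear form `(Dᵗ w)ᵗ (DᵗD)⁻¹ (Dᵗ v)`. -/
noncomputable def fittedForm (z : Fin n → Fin p → ℝ) (w v : Fin n → ℝ) : ℝ :=
  designMoment z w ⬝ᵥ ((designGram z)⁻¹.mulVec (designMoment z v))

theorem lsResid_eq (z : Fin n → Fin p → ℝ) (w : Fin n → ℝ) :
    lsResid z w = w - (design z).mulVec (lsCoef z w) := by
  funext i
  simp [lsResid, Matrix.mulVec, dotProduct, mul_comm]

/-- Residuals ignore the column space of the design: the shift `c` passes entirely into the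
estimated coefficients. -/
theorem lsResid_add_mulVec (z : Fin n → Fin p → ℝ) (hz : (designGram z).det ≠ 0)
    (w : Fin n → ℝ) (c : Fin (p + 1) → ℝ) :
    lsResid z (w + (design z).mulVec c) = lsResid z w := by
  have h : lsCoef z (w + (design z).mulVec c) = lsCoef z w + c := by
    have : (designGram z)⁻¹ * designGram z = 1 :=
      Matrix.nonsing_inv_mul _ (isUnit_iff_ne_zero.2 hz)
    unfold designGram at this
    simp only [lsCoef, Matrix.mulVec_add, Matrix.mulVec_mulVec, this, Matrix.one_mulVec]
  rw [lsResid_eq, lsResid_eq, h, Matrix.mulVec_add]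
  abel

/-- The residual of `v` is orthogonal to the columns of the design (normal equations), so the fitted
part of `w` drops out of the product. -/
theorem sum_lsResid_mul (z : Fin n → Fin p → ℝ) (hz : (designGram z).det ≠ 0)
    (w v : Fin n → ℝ) :
    ∑ i, lsResid z w i * lsResid z v i = ∑ i, w i * v i - fittedForm z w v := by
  have hG : designGram z * (designGram z)⁻¹ = 1 :=
    Matrix.mul_nonsing_inv _ (isUnit_iff_ne_zero.2 hz)
  have hv : (design z).transpose.mulVec (lsResid z v) = 0 := by
    rw [lsResid_eq, Matrix.mulVec_sub, Matrix.mulVec_mulVec]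
    change _ - (designGram z).mulVec ((designGram z)⁻¹.mulVec _) = 0
    rw [Matrix.mulVec_mulVec, hG, Matrix.one_mulVec, sub_self]
  change lsResid z w ⬝ᵥ lsResid z v = w ⬝ᵥ v - _
  have h1 : lsResid z w ⬝ᵥ lsResid z v = w ⬝ᵥ lsResid z v := by
    conv_lhs => rw [lsResid_eq z w]
    rw [sub_dotProduct, ← Matrix.vecMul_transpose, ← Matrix.dotProduct_mulVec, hv,
      dotProduct_zero, sub_zero]
  rw [h1, lsResid_eq, dotProduct_sub, Matrix.dotProduct_mulVec, ← Matrix.mulVec_transpose]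
  rfl

theorem R2Hat_eq (x y : Fin n → ℝ) (z : Fin n → Fin p → ℝ) :
    R2Hat x y z = (∑ i, lsResid z x i * lsResid z y i) ^ 2 /
      ((∑ i, lsResid z x i * lsResid z x i) * ∑ i, lsResid z y i * lsResid z y i) := by
  simp only [R2Hat, alphaHat, thetaHat, div_mul_div_comm, ← sq]

/-- The empirical counterpart of `𝔼(xy) / (𝔼(x²) 𝔼(y²))`, computed from the residuals. -/
noncomputable def kappaHat (x y : Fin n → ℝ) (z : Fin n → Fin p → ℝ) : ℝ :=
  n * (∑ i, lsResid z x i * lsResid z y i) /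
    ((∑ i, lsResid z x i * lsResid z x i) * ∑ i, lsResid z y i * lsResid z y i)

/-- The inverse is the adjugate divided by the determinant, both polynomial in the entries;
inversion on ℝ is measurable with its value 0 at 0, so singular matrices need no separate treatment.
-/
theorem measurable_matrix_inv_apply {m : ℕ} (i j : Fin m) :
    Measurable fun M : Fin m → Fin m → ℝ => (Matrix.of M)⁻¹ i j := by
  simp only [Matrix.inv_def, Ring.inverse_eq_inv', Matrix.smul_apply, smul_eq_mul]
  refine Measurable.mul (Measurable.inv (Continuous.measurable ?_)) (Continuous.measurable ?_)
  · exact Continuous.matrix_det (A := fun M : Fin m → Fin m → ℝ => Matrix.of M) continuous_id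
  · exact (Continuous.matrix_adjugate
      (A := fun M : Fin m → Fin m → ℝ => Matrix.of M) continuous_id).matrix_elem i j

theorem measurable_design_apply {Ω : Type*} [MeasurableSpace Ω] {z : Ω → Fin n → Fin p → ℝ}
    (hz : Measurable z) (i : Fin n) (j : Fin (p + 1)) :
    Measurable fun ω => design (z ω) i j := by
  exact (measurable_consOne_apply j).comp ((measurable_pi_apply i).comp hz)

theorem measurable_lsResid {Ω : Type*} [MeasurableSpace Ω] {z : Ω → Fin n → Fin p → ℝ}
    {w : Ω → Fin n → ℝ} (hz : Measurable z) (hw : Measurable w) (i : Fin n) :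
    Measurable fun ω => lsResid (z ω) (w ω) i := by
  have hd := measurable_design_apply hz
  have hG : Measurable fun ω (j k : Fin (p + 1)) =>
      ((design (z ω)).transpose * design (z ω)) j k := by
    simp only [Matrix.mul_apply, Matrix.transpose_apply]
    fun_prop
  have hI (j k : Fin (p + 1)) : Measurable fun ω =>
      ((design (z ω)).transpose * design (z ω))⁻¹ j k :=
    (measurable_matrix_inv_apply j k).comp hG
  have hw' (i : Fin n) : Measurable fun ω => w ω i := (measurable_pi_apply i).comp hw
  simp only [lsResid, lsCoef, Matrix.mulVec, dotProduct, Matrix.transpose_apply]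
  refine (hw' i).sub (Finset.measurable_fun_sum _ fun j _ => Measurable.mul ?_ (hd i j))
  exact Finset.measurable_fun_sum _ fun k _ => (hI j k).mul
    (Finset.measurable_fun_sum _ fun m _ => (hd m k).mul (hw' m))

theorem measurable_R2Hat : Measurable fun d : (Fin n → ℝ) × (Fin n → ℝ) × (Fin n → Fin p → ℝ) =>
    R2Hat d.1 d.2.1 d.2.2 := by
  have hx := measurable_lsResid
    (Ω := (Fin n → ℝ) × (Fin n → ℝ) × (Fin n → Fin p → ℝ)) measurable_snd.snd measurable_fst
  have hy := measurable_lsResid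
    (Ω := (Fin n → ℝ) × (Fin n → ℝ) × (Fin n → Fin p → ℝ)) measurable_snd.snd measurable_snd.fst
  simp only [R2Hat_eq]
  fun_prop

theorem measurable_kappaHat :
    Measurable fun d : (Fin n → ℝ) × (Fin n → ℝ) × (Fin n → Fin p → ℝ) =>
      kappaHat d.1 d.2.1 d.2.2 := by
  have hx := measurable_lsResid
    (Ω := (Fin n → ℝ) × (Fin n → ℝ) × (Fin n → Fin p → ℝ)) measurable_snd.snd measurable_fst
  have hy := measurable_lsResid
    (Ω := (Fin n → ℝ) × (Fin n → ℝ) × (Fin n → Fin p → ℝ)) measurable_snd.snd measurable_snd.fst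
  simp only [kappaHat]
  fun_prop

theorem aemeasurable_R2Hat {Ω : Type*} [MeasurableSpace Ω] {P : Measure Ω}
    {x y : Ω → Fin n → ℝ} {z : Ω → Fin n → Fin p → ℝ} (hx : AEMeasurable x P)
    (hy : AEMeasurable y P) (hz : AEMeasurable z P) :
    AEMeasurable (fun ω => R2Hat (x ω) (y ω) (z ω)) P :=
  Measurable.comp_aemeasurable (f := fun ω => (x ω, y ω, z ω))
    (g := fun d : (Fin n → ℝ) × (Fin n → ℝ) × (Fin n → Fin p → ℝ) => R2Hat d.1 d.2.1 d.2.2)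
    measurable_R2Hat (hx.prodMk (hy.prodMk hz))

theorem aemeasurable_kappaHat {Ω : Type*} [MeasurableSpace Ω] {P : Measure Ω}
    {x y : Ω → Fin n → ℝ} {z : Ω → Fin n → Fin p → ℝ} (hx : AEMeasurable x P)
    (hy : AEMeasurable y P) (hz : AEMeasurable z P) :
    AEMeasurable (fun ω => kappaHat (x ω) (y ω) (z ω)) P :=
  Measurable.comp_aemeasurable (f := fun ω => (x ω, y ω, z ω))
    (g := fun d : (Fin n → ℝ) × (Fin n → ℝ) × (Fin n → Fin p → ℝ) => kappaHat d.1 d.2.1 d.2.2)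
    measurable_kappaHat (hx.prodMk (hy.prodMk hz))

end LeastSquares

/-! ### Deterministic asymptotics along one sample path. -/

section Limits

variable {p : ℕ} {l : Filter ℕ}

/-- The restriction of a sequence to its first `n` terms. -/
def firstTerms {E : Type*} (f : ℕ → E) (n : ℕ) : Fin n → E := fun i => f i

theorem tendsto_matrix_inv {m : ℕ} {G : ℕ → Matrix (Fin m) (Fin m) ℝ}
    {Γ : Matrix (Fin m) (Fin m) ℝ} (hΓ : Γ.det ≠ 0) (h : Tendsto G l (𝓝 Γ)) :
    Tendsto (fun n => (G n)⁻¹) l (𝓝 Γ⁻¹) := by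
  simp only [Matrix.inv_def, Ring.inverse_eq_inv']
  refine Tendsto.smul (Tendsto.inv₀ ?_ hΓ) ?_
  · exact ((continuous_id.matrix_det).tendsto Γ).comp h
  · exact ((continuous_id.matrix_adjugate).tendsto Γ).comp h

/-- If the rescaled design matrices converge to an invertible matrix and `Dᵗ w`, `Dᵗ v` are
`o(n ^ (3/4))`, then `(Dᵗ w)ᵗ (DᵗD)⁻¹ (Dᵗ v)` is `o(√n)`. -/
theorem tendsto_fittedForm_div_sqrt {z : ℕ → Fin p → ℝ} {w v : ℕ → ℝ}
    {Γ : Matrix (Fin (p + 1)) (Fin (p + 1)) ℝ} (hΓ : Γ.det ≠ 0) (hl : l ≤ atTop)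
    (hG : Tendsto (fun n : ℕ => (n : ℝ)⁻¹ • designGram (firstTerms z n)) l (𝓝 Γ))
    (hw : ∀ j, Tendsto (fun n : ℕ => designMoment (firstTerms z n) (firstTerms w n) j ^ 2 /
      (n * √n)) l (𝓝 0))
    (hv : ∀ j, Tendsto (fun n : ℕ => designMoment (firstTerms z n) (firstTerms v n) j ^ 2 /
      (n * √n)) l (𝓝 0)) :
    Tendsto (fun n : ℕ => fittedForm (firstTerms z n) (firstTerms w n) (firstTerms v n) / √n) l
      (𝓝 0) := by
  have hinv := tendsto_matrix_inv hΓ hG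
  have hprod (j k) : Tendsto (fun n : ℕ => designMoment (firstTerms z n) (firstTerms w n) j *
      designMoment (firstTerms z n) (firstTerms v n) k / (n * √n)) l (𝓝 0) := by
    -- Cross products reduce to squares through |st| ≤ s² + t².
    refine squeeze_zero_norm (fun n => ?_) (by simpa using (hw j).add (hv k))
    rw [Real.norm_eq_abs, abs_div, abs_of_nonneg (by positivity : (0 : ℝ) ≤ n * √n), ← add_div]
    gcongr
    rw [abs_le]
    constructor <;> nlinarith [sq_nonneg (designMoment (firstTerms z n) (firstTerms w n) j +
      designMoment (firstTerms z n) (firstTerms v n) k),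
      sq_nonneg (designMoment (firstTerms z n) (firstTerms w n) j -
      designMoment (firstTerms z n) (firstTerms v n) k),
      sq_nonneg (designMoment (firstTerms z n) (firstTerms w n) j),
      sq_nonneg (designMoment (firstTerms z n) (firstTerms v n) k)]
  have hsum : Tendsto (fun n : ℕ => ∑ j, ∑ k, designMoment (firstTerms z n) (firstTerms w n) j *
      designMoment (firstTerms z n) (firstTerms v n) k / (n * √n) *
      ((n : ℝ)⁻¹ • designGram (firstTerms z n))⁻¹ j k) l (𝓝 0) := by
    have := tendsto_finsetSum Finset.univ fun j _ => tendsto_finsetSum Finset.univ fun k _ =>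
      (hprod j k).mul ((tendsto_pi_nhds.1 (tendsto_pi_nhds.1 hinv j) k))
    simpa using this
  refine hsum.congr' ?_
  filter_upwards [hl (eventually_gt_atTop 0)] with n hn
  have hn' : (n : ℝ) ≠ 0 := by positivity
  have hs : √(n : ℝ) ≠ 0 := by positivity
  -- This also holds for a singular Gram matrix: both inverses are then 0.
  have hI : ((n : ℝ)⁻¹ • designGram (firstTerms z n))⁻¹ =
      (n : ℝ) • (designGram (firstTerms z n))⁻¹ := by
    by_cases hd : IsUnit (designGram (firstTerms z n)).det
    · have := Matrix.inv_smul' _ (Units.mk0 (n : ℝ)⁻¹ (inv_ne_zero hn')) hd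
      simpa [Units.smul_def] using! this
    · rw [Matrix.nonsing_inv_apply_not_isUnit _ hd, smul_zero,
        Matrix.nonsing_inv_apply_not_isUnit]
      simpa [Matrix.det_smul, hn'] using hd
  simp only [hI, fittedForm, dotProduct, Matrix.mulVec, Finset.mul_sum, Finset.sum_div,
    Matrix.smul_apply, smul_eq_mul]
  refine Finset.sum_congr rfl fun j _ => Finset.sum_congr rfl fun k _ => ?_
  field_simp

/-- The expansion of `√n (R̂² - αθ)` in terms of sums of products of residuals. -/
theorem tendsto_sqrt_mul_sub_sub {a b c U₁ U₂ r₁ r₂ : ℕ → ℝ} {α θ Va Vb C : ℝ} (hl : l ≤ atTop)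
    (hVa : Va ≠ 0) (hVb : Vb ≠ 0)
    (ha : Tendsto (fun n : ℕ => a n / n) l (𝓝 Va)) (hb : Tendsto (fun n : ℕ => b n / n) l (𝓝 Vb))
    (hc : Tendsto (fun n : ℕ => c n / n) l (𝓝 C))
    (h₁ : ∀ᶠ n in l, c n - α * a n = U₁ n - r₁ n) (h₂ : ∀ᶠ n in l, c n - θ * b n = U₂ n - r₂ n)
    (hr₁ : Tendsto (fun n : ℕ => r₁ n / √n) l (𝓝 0))
    (hr₂ : Tendsto (fun n : ℕ => r₂ n / √n) l (𝓝 0))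
    (hU₁ : Tendsto (fun n : ℕ => U₁ n ^ 2 / (n * √n)) l (𝓝 0))
    (hU₂ : Tendsto (fun n : ℕ => U₂ n ^ 2 / (n * √n)) l (𝓝 0)) :
    Tendsto (fun n : ℕ => √n * (c n ^ 2 / (a n * b n) - α * θ) -
      n * c n / (a n * b n) * ((√n)⁻¹ * (U₁ n + U₂ n))) l (𝓝 0) := by
  have hsq : Tendsto (fun n : ℕ => (√(n : ℝ))⁻¹) l (𝓝 0) :=
    (tendsto_inv_atTop_zero.comp (Real.tendsto_sqrt_atTop.comp
      tendsto_natCast_atTop_atTop)).mono_left hl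
  -- Uses (U − r)² ≤ 2U² + 2r² and r²/(n√n) = (r/√n)²/√n.
  have hV {U r : ℕ → ℝ} (hr : Tendsto (fun n : ℕ => r n / √n) l (𝓝 0))
      (hU : Tendsto (fun n : ℕ => U n ^ 2 / (n * √n)) l (𝓝 0)) :
      Tendsto (fun n : ℕ => (U n - r n) ^ 2 / (n * √n)) l (𝓝 0) := by
    have h3 : Tendsto (fun n : ℕ => 2 * (U n ^ 2 / (n * √n)) +
        2 * ((r n / √n) ^ 2 * (√(n : ℝ))⁻¹)) l (𝓝 0) := by
      simpa using (hU.const_mul 2).add (((hr.pow 2).mul hsq).const_mul 2)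
    refine squeeze_zero (fun n => by positivity) (fun n => ?_) h3
    rw [div_pow, Real.sq_sqrt (by positivity), ← div_eq_mul_inv, div_div, ← mul_div_assoc,
      ← mul_div_assoc, ← add_div]
    gcongr
    nlinarith [sq_nonneg (U n + r n)]
  have hV12 : Tendsto (fun n : ℕ => (U₁ n - r₁ n) * (U₂ n - r₂ n) / (n * √n)) l (𝓝 0) := by
    refine squeeze_zero_norm (fun n => ?_) (by simpa using (hV hr₁ hU₁).add (hV hr₂ hU₂))
    rw [Real.norm_eq_abs, abs_div, abs_of_nonneg (by positivity : (0 : ℝ) ≤ n * √n), ← add_div]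
    gcongr
    generalize U₁ n - r₁ n = s
    generalize U₂ n - r₂ n = t
    rw [abs_le]
    constructor <;> nlinarith [sq_nonneg (s + t), sq_nonneg (s - t), sq_nonneg s, sq_nonneg t]
  have hab := ha.mul hb
  -- This is the remainder left by c² − αθab = c(V₁ + V₂) − V₁V₂ with Vᵢ = Uᵢ − rᵢ: the terms in rᵢ,
  -- and the product V₁V₂.
  have hlim : Tendsto (fun n : ℕ => -(c n / n / (a n / n * (b n / n)) * (r₁ n / √n + r₂ n / √n))
      - (U₁ n - r₁ n) * (U₂ n - r₂ n) / (n * √n) / (a n / n * (b n / n))) l (𝓝 0) := by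
    have := (((hc.div hab (mul_ne_zero hVa hVb)).mul (hr₁.add hr₂)).neg).sub
      (hV12.div hab (mul_ne_zero hVa hVb))
    simpa using! this
  refine hlim.congr' ?_
  filter_upwards [hl (eventually_gt_atTop 0), h₁, h₂, ha.eventually_ne hVa, hb.eventually_ne hVb]
    with n hn e₁ e₂ hna hnb
  have hn' : (n : ℝ) ≠ 0 := by positivity
  have hs : √(n : ℝ) ≠ 0 := by positivity
  have ha0 : a n ≠ 0 := fun h => hna (by simp [h])
  have hb0 : b n ≠ 0 := fun h => hnb (by simp [h])
  have hss : √(n : ℝ) ^ 2 = n := Real.sq_sqrt (by positivity)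
  have hU1 : U₁ n = c n - α * a n + r₁ n := by linarith
  have hU2 : U₂ n = c n - θ * b n + r₂ n := by linarith
  rw [hU1, hU2]
  -- With n replaced by s², the claim becomes an identity of rational functions.
  generalize √(n : ℝ) = s at *
  rw [← hss]
  field_simp
  ring

theorem lsResid_firstTerms {z : ℕ → Fin p → ℝ} {X x : ℕ → ℝ} {c : Fin (p + 1) → ℝ} {n : ℕ}
    (hX : ∀ i, x i = X i - ∑ j, c j * consOne (z i) j)
    (hz : (designGram (firstTerms z n)).det ≠ 0) :
    lsResid (firstTerms z n) (firstTerms X n) = lsResid (firstTerms z n) (firstTerms x n) := by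
  rw [← lsResid_add_mulVec _ hz (firstTerms x n) c]
  congr 1
  funext i
  have h : ∑ j, design (firstTerms z n) i j * c j = ∑ j, c j * consOne (z i) j :=
    Finset.sum_congr rfl fun j _ => mul_comm _ _
  simp [firstTerms, Matrix.mulVec, dotProduct, hX, h]

/-- Pathwise expansion of the estimator: the data `X`, `Y` are affine functions of `z` plus the
errors `x`, `y`. -/
theorem tendsto_R2Hat_expansion {z : ℕ → Fin p → ℝ} {X Y x y : ℕ → ℝ} {c c' : Fin (p + 1) → ℝ}
    {Γ : Matrix (Fin (p + 1)) (Fin (p + 1)) ℝ} {α θ Vx Vy C : ℝ}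
    (hX : ∀ i, x i = X i - ∑ j, c j * consOne (z i) j)
    (hY : ∀ i, y i = Y i - ∑ j, c' j * consOne (z i) j)
    (hl : l ≤ atTop) (hΓ : Γ.det ≠ 0) (hVx : Vx ≠ 0) (hVy : Vy ≠ 0)
    (hG : ∀ j k, Tendsto (fun n : ℕ => (∑ i : Fin n, consOne (z i) j * consOne (z i) k) / n) l
      (𝓝 (Γ j k)))
    (hxx : Tendsto (fun n : ℕ => (∑ i : Fin n, x i * x i) / n) l (𝓝 Vx))
    (hyy : Tendsto (fun n : ℕ => (∑ i : Fin n, y i * y i) / n) l (𝓝 Vy))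
    (hxy : Tendsto (fun n : ℕ => (∑ i : Fin n, x i * y i) / n) l (𝓝 C))
    (hmx : ∀ j, Tendsto (fun n : ℕ => (∑ i : Fin n, consOne (z i) j * x i) ^ 2 / (n * √n)) l
      (𝓝 0))
    (hmy : ∀ j, Tendsto (fun n : ℕ => (∑ i : Fin n, consOne (z i) j * y i) ^ 2 / (n * √n)) l
      (𝓝 0))
    (hU₁ : Tendsto (fun n : ℕ => (∑ i : Fin n, x i * (y i - α * x i)) ^ 2 / (n * √n)) l (𝓝 0))
    (hU₂ : Tendsto (fun n : ℕ => (∑ i : Fin n, y i * (x i - θ * y i)) ^ 2 / (n * √n)) l (𝓝 0)) :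
    Tendsto (fun n : ℕ => kappaHat (firstTerms X n) (firstTerms Y n) (firstTerms z n)) l
      (𝓝 (C / (Vx * Vy))) ∧
    Tendsto (fun n : ℕ =>
      √n * (R2Hat (firstTerms X n) (firstTerms Y n) (firstTerms z n) - α * θ) -
        kappaHat (firstTerms X n) (firstTerms Y n) (firstTerms z n) *
          ((√n)⁻¹ * (∑ i : Fin n, x i * (y i - α * x i) + ∑ i : Fin n, y i * (x i - θ * y i))))
      l (𝓝 0) := by
  replace hG : Tendsto (fun n : ℕ => (n : ℝ)⁻¹ • designGram (firstTerms z n)) l (𝓝 Γ) := by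
    refine tendsto_pi_nhds.2 fun j => tendsto_pi_nhds.2 fun k => (hG j k).congr fun n => ?_
    rw [div_eq_inv_mul]
    rfl
  -- The determinant of the rescaled Gram matrix tends to a nonzero number, so the design is
  -- eventually of full rank.
  have hdet : ∀ᶠ n : ℕ in l, (designGram (firstTerms z n)).det ≠ 0 := by
    have := (((continuous_id.matrix_det).tendsto Γ).comp hG).eventually_ne hΓ
    filter_upwards [this] with n hn h0
    exact hn (by simp [h0])
  have hsq : Tendsto (fun n : ℕ => (√(n : ℝ))⁻¹) l (𝓝 0) :=
    (tendsto_inv_atTop_zero.comp (Real.tendsto_sqrt_atTop.comp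
      tendsto_natCast_atTop_atTop)).mono_left hl
  have fxx := tendsto_fittedForm_div_sqrt hΓ hl hG hmx hmx
  have fyy := tendsto_fittedForm_div_sqrt hΓ hl hG hmy hmy
  have fxy := tendsto_fittedForm_div_sqrt hΓ hl hG hmx hmy
  have hmean {w v W V : ℕ → ℝ} {d d' : Fin (p + 1) → ℝ} {L : ℝ}
      (hW : ∀ i, w i = W i - ∑ j, d j * consOne (z i) j)
      (hV : ∀ i, v i = V i - ∑ j, d' j * consOne (z i) j)
      (h1 : Tendsto (fun n : ℕ => (∑ i : Fin n, w i * v i) / n) l (𝓝 L))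
      (h2 : Tendsto (fun n : ℕ => fittedForm (firstTerms z n) (firstTerms w n) (firstTerms v n) /
        √n) l (𝓝 0)) :
      Tendsto (fun n : ℕ => (∑ i, lsResid (firstTerms z n) (firstTerms W n) i *
        lsResid (firstTerms z n) (firstTerms V n) i) / n) l (𝓝 L) := by
    have h3 := h1.sub (h2.mul hsq)
    rw [mul_zero, sub_zero] at h3
    refine h3.congr' ?_
    filter_upwards [hdet] with n hn
    rw [lsResid_firstTerms hW hn, lsResid_firstTerms hV hn, sum_lsResid_mul _ hn, sub_div,
      ← div_eq_mul_inv, div_div, Real.mul_self_sqrt (by positivity)]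
    rfl
  have ha := hmean hX hX hxx fxx
  have hb := hmean hY hY hyy fyy
  have hc := hmean hX hY hxy fxy
  refine ⟨?_, ?_⟩
  · refine (hc.div (ha.mul hb) (mul_ne_zero hVx hVy)).congr' ?_
    filter_upwards [hl (eventually_gt_atTop 0)] with n hn
    have hn' : (n : ℝ) ≠ 0 := by positivity
    simp only [kappaHat, Pi.div_apply]
    rw [div_mul_div_comm, div_div_eq_mul_div, div_mul_eq_mul_div, div_div,
      ← mul_div_mul_right _ _ hn']
    field_simp
  · have key := tendsto_sqrt_mul_sub_sub (α := α) (θ := θ)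
      (U₁ := fun n => ∑ i : Fin n, x i * (y i - α * x i))
      (U₂ := fun n => ∑ i : Fin n, y i * (x i - θ * y i))
      (r₁ := fun n => fittedForm (firstTerms z n) (firstTerms x n) (firstTerms y n) -
        α * fittedForm (firstTerms z n) (firstTerms x n) (firstTerms x n))
      (r₂ := fun n => fittedForm (firstTerms z n) (firstTerms x n) (firstTerms y n) -
        θ * fittedForm (firstTerms z n) (firstTerms y n) (firstTerms y n))
      hl hVx hVy ha hb hc ?_ ?_ ?_ ?_ hU₁ hU₂
    · simpa only [R2Hat_eq, kappaHat] using key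
    · filter_upwards [hdet] with n hn
      rw [lsResid_firstTerms hX hn, lsResid_firstTerms hY hn, sum_lsResid_mul _ hn,
        sum_lsResid_mul _ hn]
      have : ∑ i : Fin n, x i * (y i - α * x i) =
          ∑ i, firstTerms x n i * firstTerms y n i -
            α * ∑ i, firstTerms x n i * firstTerms x n i := by
        rw [Finset.mul_sum, ← Finset.sum_sub_distrib]
        exact Finset.sum_congr rfl fun i _ => by simp only [firstTerms]; ring
      rw [this]
      ring
    · filter_upwards [hdet] with n hn
      rw [lsResid_firstTerms hX hn, lsResid_firstTerms hY hn, sum_lsResid_mul _ hn,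
        sum_lsResid_mul _ hn]
      have : ∑ i : Fin n, y i * (x i - θ * y i) =
          ∑ i, firstTerms x n i * firstTerms y n i -
            θ * ∑ i, firstTerms y n i * firstTerms y n i := by
        rw [Finset.mul_sum, ← Finset.sum_sub_distrib]
        exact Finset.sum_congr rfl fun i _ => by simp only [firstTerms]; ring
      rw [this]
      ring
    · simpa [sub_div, mul_div_assoc] using fxy.sub (fxx.const_mul α)
    · simpa [sub_div, mul_div_assoc] using fxy.sub (fyy.const_mul θ)

end Limits

/-! ### Limit theorems for independent copies, and Slutsky's theorem. -/

section Copies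

variable {Ω Ω' E : Type*} [MeasurableSpace Ω] [MeasurableSpace Ω'] [MeasurableSpace E]
  {μ : Measure Ω} {P : Measure Ω'}
  {T : Ω → E} {S : ℕ → Ω' → E}

/-- The strong law of large numbers for a function of independent copies. -/
theorem ae_tendsto_sum_div (hcopy : ∀ i, IdentDistrib (S i) T P μ) (hindep : iIndepFun S P)
    {g : E → ℝ} (hg : Measurable g) (hint : Integrable (fun ω => g (T ω)) μ) :
    ∀ᵐ ω' ∂P, Tendsto (fun n : ℕ => (∑ i : Fin n, g (S i ω')) / n) atTop
      (𝓝 (∫ ω, g (T ω) ∂μ)) := by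
  have hid (i : ℕ) : IdentDistrib (fun ω' => g (S i ω')) (fun ω => g (T ω)) P μ :=
    (hcopy i).comp hg
  have h := strong_law_ae_real (μ := P) (fun i ω' => g (S i ω'))
    ((hid 0).integrable_iff.2 hint)
    (fun i j hij => (hindep.indepFun hij).comp hg hg) (fun i => (hid i).trans (hid 0).symm)
  rw [(hid 0).integral_eq] at h
  simpa only [Finset.sum_range] using h

variable [IsProbabilityMeasure P]

/-- The central limit theorem for a centered function of independent copies. -/
theorem tendstoInDistribution_inv_sqrt_mul_sum_fin (hcopy : ∀ i, IdentDistrib (S i) T P μ)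
    (hindep : iIndepFun S P) {g : E → ℝ} (hg : Measurable g)
    (hmem : MemLp (fun ω => g (T ω)) 2 μ) (h0 : ∫ ω, g (T ω) ∂μ = 0) :
    TendstoInDistribution (fun (n : ℕ) ω' => (√n)⁻¹ * ∑ i : Fin n, g (S i ω')) atTop id
      (fun _ => P) (gaussianReal 0 (∫ ω, g (T ω) ^ 2 ∂μ).toNNReal) := by
  have hid (i : ℕ) : IdentDistrib (fun ω' => g (S i ω')) (fun ω => g (T ω)) P μ :=
    (hcopy i).comp hg
  have hv : variance (fun ω' => g (S 0 ω')) P = ∫ ω, g (T ω) ^ 2 ∂μ := by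
    rw [(hid 0).variance_eq, variance_of_integral_eq_zero hmem.aemeasurable h0]
  have h := tendstoInDistribution_inv_sqrt_mul_sum_sub (P := P) (X := fun i ω' => g (S i ω'))
    (Y := id) (P' := gaussianReal 0 (∫ ω, g (T ω) ^ 2 ∂μ).toNNReal)
    (by rw [hv]; exact HasLaw.id) ((hid 0).memLp_iff.2 hmem)
    (hindep.comp (fun _ => g) (fun _ => hg)) (fun i => (hid i).trans (hid 0).symm)
  simpa only [Finset.sum_range, (hid 0).integral_eq, h0, mul_zero, sub_zero] using h

/-- The sums of `n` independent copies of centered square integrable variables are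
`o(n ^ (3/4))` in probability. -/
theorem tendstoInMeasure_sum_sq_div (hcopy : ∀ i, IdentDistrib (S i) T P μ)
    (hindep : iIndepFun S P) {κ : Type*} [Fintype κ] {g : κ → E → ℝ} (hg : ∀ k, Measurable (g k))
    (hmem : ∀ k, MemLp (fun ω => g k (T ω)) 2 μ) (h0 : ∀ k, ∫ ω, g k (T ω) ∂μ = 0) :
    TendstoInMeasure P
      (fun (n : ℕ) ω' => ∑ k, (∑ i : Fin n, g k (S i ω')) ^ 2 / (n * √n)) atTop 0 := by
  have hid (k : κ) (i : ℕ) : IdentDistrib (fun ω' => g k (S i ω')) (fun ω => g k (T ω)) P μ :=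
    (hcopy i).comp (hg k)
  have hLp (k : κ) (i : ℕ) : MemLp (fun ω' => g k (S i ω')) 2 P := (hid k i).memLp_iff.2 (hmem k)
  have hsum (k : κ) (n : ℕ) : MemLp (fun ω' => ∑ i : Fin n, g k (S i ω')) 2 P :=
    memLp_finsetSum _ fun i _ => hLp k i
  have hsq (k : κ) (n : ℕ) :
      ∫ ω', (∑ i : Fin n, g k (S i ω')) ^ 2 ∂P = n * ∫ ω, g k (T ω) ^ 2 ∂μ := by
    have hz : ∫ ω', ∑ i : Fin n, g k (S i ω') ∂P = 0 := by
      rw [integral_finsetSum Finset.univ fun (i : Fin n) _ => (hLp k i).integrable (by norm_num)]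
      simp [(hid k _).integral_eq, h0]
    rw [← variance_of_integral_eq_zero (hsum k n).aemeasurable hz]
    have := IndepFun.variance_sum (μ := P) (s := Finset.univ)
      (X := fun (i : Fin n) ω' => g k (S i ω')) (fun i _ => hLp k i)
      (fun i _ j _ hij => (hindep.indepFun (by simpa [Fin.ext_iff] using hij)).comp (hg k) (hg k))
    rw [show (fun ω' => ∑ i : Fin n, g k (S i ω')) = ∑ i : Fin n, fun ω' => g k (S i ω') by
      ext; simp, this]
    simp [(hid k _).variance_eq, variance_of_integral_eq_zero (hmem k).aemeasurable (h0 k)]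
  -- By pairwise independence the L¹ norm is a constant times n/(n√n), which tends to 0.
  refine tendstoInMeasure_of_tendsto_eLpNorm (p := 1) (by simp) (fun n => ?_) (by fun_prop) ?_
  · exact Finset.aestronglyMeasurable_fun_sum _ fun k _ =>
      (hsum k n).integrable_sq.div_const _ |>.aestronglyMeasurable
  have hint (n : ℕ) : Integrable
      (fun ω' => ∑ k, (∑ i : Fin n, g k (S i ω')) ^ 2 / (n * √n)) P :=
    integrable_finsetSum _ fun k _ => (hsum k n).integrable_sq.div_const _
  have hval (n : ℕ) : eLpNorm
      ((fun ω' => ∑ k, (∑ i : Fin n, g k (S i ω')) ^ 2 / (n * √n)) - 0) 1 P =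
      ENNReal.ofReal ((∑ k, ∫ ω, g k (T ω) ^ 2 ∂μ) * (n / (n * √n))) := by
    rw [sub_zero, eLpNorm_one_eq_lintegral_enorm, ← ofReal_integral_norm_eq_lintegral_enorm (hint n)]
    congr 1
    simp only [Real.norm_eq_abs]
    simp_rw [fun ω' => abs_of_nonneg (show 0 ≤ ∑ k, (∑ i : Fin n, g k (S i ω')) ^ 2 / (n * √n) by
      positivity)]
    rw [integral_finsetSum _ fun k _ => (hsum k n).integrable_sq.div_const _, Finset.sum_mul]
    refine Finset.sum_congr rfl fun k _ => ?_
    rw [integral_div, hsq]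
    ring
  simp_rw [hval]
  rw [← ENNReal.ofReal_zero]
  refine ENNReal.tendsto_ofReal ?_
  have hsqrt : Tendsto (fun n : ℕ => (√(n : ℝ))⁻¹) atTop (𝓝 0) :=
    tendsto_inv_atTop_zero.comp (Real.tendsto_sqrt_atTop.comp tendsto_natCast_atTop_atTop)
  have : Tendsto (fun n : ℕ => (n / (n * √n) : ℝ)) atTop (𝓝 0) := by
    refine hsqrt.congr' ?_
    filter_upwards [eventually_gt_atTop 0] with n hn
    have : (n : ℝ) ≠ 0 := by positivity
    field_simp
  simpa using this.const_mul (∑ k, ∫ ω, g k (T ω) ^ 2 ∂μ)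

/-- If every subsequence of a sequence converging to `0` in probability along which there is
almost sure convergence gives almost sure convergence of another sequence, then the latter
converges in probability too. -/
theorem tendstoInMeasure_zero_of_ae_imp {H F : ℕ → Ω' → ℝ} (hH : TendstoInMeasure P H atTop 0)
    (hF : ∀ n, AEStronglyMeasurable (F n) P)
    (himp : ∀ᵐ ω' ∂P, ∀ l ≤ (atTop : Filter ℕ), Tendsto (fun n => H n ω') l (𝓝 0) →
      Tendsto (fun n => F n ω') l (𝓝 0)) :
    TendstoInMeasure P F atTop 0 := by
  rw [exists_seq_tendstoInMeasure_atTop_iff hF]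
  intro ns hns
  obtain ⟨ms, hms, hae⟩ := (hH.comp hns.tendsto_atTop).exists_seq_tendsto_ae
  refine ⟨ms, hms, ?_⟩
  filter_upwards [hae, himp] with ω' h1 h2
  -- A subsequence is encoded as the image filter of `atTop`. As the pathwise implication covers all
  -- filters at once, its null set does not depend on the subsequence.
  have := h2 (map (fun i => ns (ms i)) atTop) ((hns.comp hms).tendsto_atTop)
    (tendsto_map'_iff.2 h1)
  exact tendsto_map'_iff.1 this

/-- Only the law of the limit matters; this allows a multiple of one Gaussian to be replaced by the
identity under the rescaled Gaussian. -/
theorem tendstoInDistribution_congr_law {Ω₁ Ω₂ : Type*} [MeasurableSpace Ω₁] [MeasurableSpace Ω₂]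
    {μ₁ : Measure Ω₁} {μ₂ : Measure Ω₂} [IsProbabilityMeasure μ₁] [IsProbabilityMeasure μ₂]
    {F : ℕ → Ω' → ℝ} {U : Ω₁ → ℝ} {V : Ω₂ → ℝ} (hUV : IdentDistrib U V μ₁ μ₂)
    (h : TendstoInDistribution F atTop U (fun _ => P) μ₁) :
    TendstoInDistribution F atTop V (fun _ => P) μ₂ where
  forall_aemeasurable := h.forall_aemeasurable
  aemeasurable_limit := hUV.aemeasurable_snd
  tendsto := by
    have := h.tendsto
    simp only [hUV.map_eq] at this
    exact this

/-- Slutsky's theorem for `κ F + e`, with a Gaussian limit. -/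
theorem tendstoInDistribution_gaussian_of_sub {F R κ : ℕ → Ω' → ℝ} {c : ℝ} {v : NNReal}
    (hF : TendstoInDistribution F atTop id (fun _ => P) (gaussianReal 0 v))
    (hκm : ∀ n, AEMeasurable (κ n) P) (hRm : ∀ n, AEMeasurable (R n) P)
    (hκ : TendstoInMeasure P κ atTop fun _ => c)
    (hR : TendstoInMeasure P (fun n ω' => R n ω' - κ n ω' * F n ω') atTop 0) :
    TendstoInDistribution R atTop id (fun _ => P) (gaussianReal 0 (⟨c ^ 2, sq_nonneg c⟩ * v)) := by
  have h1 := hF.continuous_comp_prodMk_of_tendstoInMeasure_const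
    (g := fun q : ℝ × ℝ => q.2 * q.1) (by fun_prop) hκ hκm
  have h2 := tendstoInDistribution_of_tendstoInMeasure_sub R _ h1 hR hRm
  refine tendstoInDistribution_congr_law ⟨by fun_prop, by fun_prop, ?_⟩ h2
  rw [Measure.map_id]
  simp only [id]
  rw [gaussianReal_map_const_mul, mul_zero]
  rfl

end Copies

/-! ### Projections, residuals and moments in L². -/

section Population

variable {Ω : Type*} [MeasurableSpace Ω] {μ : Measure Ω}

theorem inner_eq_integral_mul (U W : Lp ℝ 2 μ) : inner ℝ U W = ∫ ω, U ω * W ω ∂μ := by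
  rw [L2.inner_def]
  exact integral_congr_ae (ae_of_all _ fun ω => by simp [mul_comm])

theorem integral_sq_pos {U : Lp ℝ 2 μ} (hU : U ≠ 0) : 0 < ∫ ω, U ω ^ 2 ∂μ := by
  simpa only [inner_eq_integral_mul, ← sq] using real_inner_self_pos.2 hU

theorem integrable_mul_Lp (U W : Lp ℝ 2 μ) : Integrable (fun ω => U ω * W ω) μ :=
  (Lp.memLp U).integrable_mul (Lp.memLp W)

theorem variance_coe_Lp {x : Lp ℝ 2 μ} (hx0 : ∫ ω, x ω ∂μ = 0) : variance x μ = ∫ ω, x ω ^ 2 ∂μ :=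
  variance_of_integral_eq_zero (Lp.aestronglyMeasurable x).aemeasurable hx0

variable [IsProbabilityMeasure μ]

theorem one_ae_eq : one μ =ᵐ[μ] fun _ => (1 : ℝ) := Lp.coeFn_const 2 μ 1

theorem withOne_ae_eq {p : ℕ} (Z : Fin p → Lp ℝ 2 μ) (j : Fin (p + 1)) :
    withOne Z j =ᵐ[μ] fun ω => consOne (fun j => Z j ω) j := by
  refine Fin.cases ?_ (fun j => ?_) j
  · exact one_ae_eq
  · simp [withOne, consOne]

theorem inner_withOne_resid {p : ℕ} (Z : Fin p → Lp ℝ 2 μ) (W : Lp ℝ 2 μ) (j : Fin (p + 1)) :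
    inner ℝ (withOne Z j) (resid Z W) = 0 :=
  (Submodule.mem_orthogonal _ _).1 (Submodule.sub_starProjection_mem_orthogonal W) _
    (Submodule.subset_span (Set.mem_range_self j))

theorem integral_consOne_mul_resid {p : ℕ} (Z : Fin p → Lp ℝ 2 μ) (W : Lp ℝ 2 μ)
    (j : Fin (p + 1)) : ∫ ω, consOne (fun j => Z j ω) j * resid Z W ω ∂μ = 0 := by
  rw [← inner_withOne_resid Z W j, inner_eq_integral_mul]
  refine integral_congr_ae ?_
  filter_upwards [withOne_ae_eq Z j] with ω h
  rw [h]

theorem inner_one (W : Lp ℝ 2 μ) : inner ℝ (one μ) W = ∫ ω, W ω ∂μ := by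
  rw [inner_eq_integral_mul]
  refine integral_congr_ae ?_
  filter_upwards [one_ae_eq (μ := μ)] with ω h
  rw [h, one_mul]

theorem resid_ae_eq {p : ℕ} (Z : Fin p → Lp ℝ 2 μ) (W : Lp ℝ 2 μ) :
    resid Z W =ᵐ[μ] fun ω => W ω - ∑ j, coef Z W j * consOne (fun j => Z j ω) j := by
  rw [resid, ← coef_spec]
  have h : ∀ᵐ ω ∂μ, ∀ j, (coef Z W j • withOne Z j : Lp ℝ 2 μ) ω =
      coef Z W j * consOne (fun j => Z j ω) j := by
    refine ae_all_iff.2 fun j => ?_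
    filter_upwards [Lp.coeFn_smul (coef Z W j) (withOne Z j), withOne_ae_eq Z j] with ω h1 h2
    rw [h1, Pi.smul_apply, h2, smul_eq_mul]
  filter_upwards [h, Lp.coeFn_sub W (∑ j, coef Z W j • withOne Z j),
    Lp.coeFn_finsetSum Finset.univ fun j => coef Z W j • withOne Z j] with ω h1 h2 h3
  rw [h2, Pi.sub_apply, h3, Finset.sum_apply]
  simp only [h1]

theorem resid_ne_zero {p : ℕ} {Z : Fin p → Lp ℝ 2 μ} {W : Lp ℝ 2 μ}
    (h : W ∉ Submodule.span ℝ (Set.range (withOne Z))) : resid Z W ≠ 0 := fun h0 => by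
  rw [resid, sub_eq_zero] at h0
  exact h (h0 ▸ Submodule.starProjection_apply_mem _ W)

theorem linearIndependent_withOne {p : ℕ} {X Y : Lp ℝ 2 μ} {Z : Fin p → Lp ℝ 2 μ}
    (h : LinearIndependent ℝ (withOne (Fin.cons X (Fin.cons Y Z)))) :
    LinearIndependent ℝ (withOne Z) ∧ X ∉ Submodule.span ℝ (Set.range (withOne Z)) ∧
      Y ∉ Submodule.span ℝ (Set.range (withOne Z)) := by
  set v : Fin (p + 1 + 1 + 1) → Lp ℝ 2 μ := withOne (Fin.cons X (Fin.cons Y Z)) with hv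
  -- `e` keeps the constant and the Zs, skipping positions 1 and 2, which hold X and Y.
  let e : Fin (p + 1) → Fin (p + 1 + 1 + 1) := Fin.cons 0 fun j => j.succ.succ.succ
  have he : v ∘ e = withOne Z := by
    funext j
    refine Fin.cases ?_ (fun j => ?_) j <;> simp [hv, e, withOne]
  have hX : v (Fin.succ 0) = X := by simp [hv, withOne]
  have hY : v (Fin.succ (Fin.succ 0)) = Y := by
    simp only [hv, withOne, Fin.cons_succ, Fin.cons_zero]
  have hinj : Function.Injective e := by
    intro i j
    refine Fin.cases ?_ (fun i => ?_) i <;> refine Fin.cases ?_ (fun j => ?_) j <;>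
      simp [e, Fin.ext_iff]
  have hn (k : Fin (p + 1 + 1 + 1)) (hk : k ∉ Set.range e) :
      v k ∉ Submodule.span ℝ (Set.range (withOne Z)) := by
    rw [← he, Set.range_comp]
    exact h.notMem_span_image hk
  refine ⟨he ▸ h.comp e hinj, hX ▸ hn _ ?_, hY ▸ hn _ ?_⟩
  all_goals
    rintro ⟨j, hj⟩
    replace hj := congrArg Fin.val hj
    revert hj
    refine Fin.cases ?_ (fun j => ?_) j <;>
      simp only [e, Fin.cons_zero, Fin.cons_succ, Fin.val_succ, Fin.val_zero] <;> omega

/-- The second moment matrix of `(1, Z 0, …, Z (p-1))`. -/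
noncomputable def secondMoment {p : ℕ} (Z : Fin p → Lp ℝ 2 μ) :
    Matrix (Fin (p + 1)) (Fin (p + 1)) ℝ :=
  Matrix.of fun j k => ∫ ω, consOne (fun j => Z j ω) j * consOne (fun j => Z j ω) k ∂μ

/-- The second moments form the Gram matrix of `withOne Z` in L², which is invertible exactly under
linear independence. -/
theorem det_secondMoment_ne_zero {p : ℕ} {Z : Fin p → Lp ℝ 2 μ}
    (h : LinearIndependent ℝ (withOne Z)) : (secondMoment Z).det ≠ 0 := by
  have : secondMoment Z = Matrix.gram ℝ (withOne Z) := by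
    ext j k
    rw [Matrix.gram_apply, inner_eq_integral_mul]
    refine integral_congr_ae ?_
    filter_upwards [withOne_ae_eq Z j, withOne_ae_eq Z k] with ω h1 h2
    rw [h1, h2]
  rw [this]
  exact Matrix.det_gram_ne_zero_iff_linearIndependent.2 h

section Regression

variable {x y : Lp ℝ 2 μ}

/-- Between centered variables, orthogonality of the residual to the constant forces a zero
intercept. -/
theorem proj_single (hx0 : ∫ ω, x ω ∂μ = 0) (hy0 : ∫ ω, y ω ∂μ = 0) :
    proj ![x] y = regSlope x y • x := by
  have h := coef_spec ![x] y
  rw [Fin.sum_univ_two] at h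
  have h0 := inner_withOne_resid ![x] y 0
  have e0 : withOne ![x] 0 = one μ := rfl
  have e1 : withOne ![x] 1 = x := rfl
  have hone : inner ℝ (one μ) (one μ) = (1 : ℝ) := by
    rw [inner_one, integral_congr_ae one_ae_eq]
    simp
  rw [e0, e1] at h
  rw [resid, ← h, e0, inner_sub_right, inner_add_right, inner_smul_right, inner_smul_right,
    inner_one x, inner_one y, hx0, hy0, hone] at h0
  have hc : coef ![x] y 0 = 0 := by linarith
  rw [← h, hc, zero_smul, zero_add]
  rfl

theorem resid_single_ae_eq (hx0 : ∫ ω, x ω ∂μ = 0) (hy0 : ∫ ω, y ω ∂μ = 0) :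
    resid ![x] y =ᵐ[μ] fun ω => y ω - regSlope x y * x ω := by
  rw [resid, proj_single hx0 hy0]
  filter_upwards [Lp.coeFn_sub y (regSlope x y • x), Lp.coeFn_smul (regSlope x y) x]
    with ω h1 h2
  rw [h1, Pi.sub_apply, h2, Pi.smul_apply, smul_eq_mul]

theorem integral_mul_resid_single : ∫ ω, x ω * resid ![x] y ω ∂μ = 0 := by
  rw [← inner_eq_integral_mul]
  exact inner_withOne_resid ![x] y 1

theorem regSlope_mul (hx0 : ∫ ω, x ω ∂μ = 0) (hy0 : ∫ ω, y ω ∂μ = 0) :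
    regSlope x y * ∫ ω, x ω ^ 2 ∂μ = ∫ ω, x ω * y ω ∂μ := by
  have h : inner ℝ x (resid ![x] y) = 0 := inner_withOne_resid ![x] y 1
  rw [resid, proj_single hx0 hy0, inner_sub_right, inner_smul_right, inner_eq_integral_mul,
    inner_eq_integral_mul] at h
  simp only [sq]
  linarith

/-- The explained variance is α²𝔼(x²) = α𝔼(xy) = αθ𝔼(y²). -/
theorem R2_eq (hx0 : ∫ ω, x ω ∂μ = 0) (hy0 : ∫ ω, y ω ∂μ = 0) (hy : y ≠ 0) :
    R2 x y = regSlope x y * regSlope y x := by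
  have h1 := regSlope_mul hx0 hy0
  have h2 := regSlope_mul hy0 hx0
  simp only [fun ω => mul_comm (y ω) (x ω)] at h2
  have hpos := integral_sq_pos hy
  rw [R2, proj_single hx0 hy0, variance_congr (Lp.coeFn_smul _ _), variance_smul,
    variance_coe_Lp hx0, variance_coe_Lp hy0, div_eq_iff hpos.ne', mul_assoc, h2, ← h1]
  ring

/-- The limiting variance is the variance of the influence function
`(x ε₁ + y ε₂) 𝔼(xy) / (𝔼(x²) 𝔼(y²))`. -/
theorem limitVar_eq (hx0 : ∫ ω, x ω ∂μ = 0) (hy0 : ∫ ω, y ω ∂μ = 0) (hx : x ≠ 0) (hy : y ≠ 0)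
    (hxε : MemLp (fun ω => x ω * resid ![x] y ω) 2 μ)
    (hyε : MemLp (fun ω => y ω * resid ![y] x ω) 2 μ) :
    limitVar x y = ((∫ ω, x ω * y ω ∂μ) / ((∫ ω, x ω ^ 2 ∂μ) * ∫ ω, y ω ^ 2 ∂μ)) ^ 2 *
      ∫ ω, (x ω * resid ![x] y ω + y ω * resid ![y] x ω) ^ 2 ∂μ := by
  have h1 := regSlope_mul hx0 hy0
  have h2 := regSlope_mul hy0 hx0
  simp only [fun ω => mul_comm (y ω) (x ω)] at h2
  have hxp := integral_sq_pos hx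
  have hyp := integral_sq_pos hy
  have hexp : ∫ ω, (x ω * resid ![x] y ω + y ω * resid ![y] x ω) ^ 2 ∂μ =
      ∫ ω, x ω ^ 2 * resid ![x] y ω ^ 2 ∂μ +
      2 * ∫ ω, x ω * y ω * resid ![x] y ω * resid ![y] x ω ∂μ +
      ∫ ω, y ω ^ 2 * resid ![y] x ω ^ 2 ∂μ := by
    have i1 : Integrable (fun ω => x ω ^ 2 * resid ![x] y ω ^ 2) μ := by
      simpa only [mul_pow] using hxε.integrable_sq
    have i2 : Integrable (fun ω => y ω ^ 2 * resid ![y] x ω ^ 2) μ := by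
      simpa only [mul_pow] using hyε.integrable_sq
    have i3 : Integrable (fun ω => x ω * y ω * resid ![x] y ω * resid ![y] x ω) μ :=
      (hxε.integrable_mul hyε).congr (ae_of_all _ fun ω => by simp only [Pi.mul_apply]; ring)
    have i4 := i3.const_mul 2
    have i5 := i1.add i4
    rw [← integral_const_mul, ← integral_add i1 i4]
    refine Eq.trans (integral_congr_ae (ae_of_all _ fun ω => ?_)) (integral_add i5 i2)
    ring
  rw [hexp, limitVar, matA, matB, variance_coe_Lp hx0, variance_coe_Lp hy0]
  -- Since α = 𝔼(xy)/𝔼(x²) and θ = 𝔼(xy)/𝔼(y²), both coordinates of B(θ, α)ᵗ equal κ, so V is κ²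
  -- times the sum of the entries of A.
  have hα : regSlope x y = (∫ ω, x ω * y ω ∂μ) / ∫ ω, x ω ^ 2 ∂μ := by
    rw [eq_div_iff hxp.ne', h1]
  have hθ : regSlope y x = (∫ ω, x ω * y ω ∂μ) / ∫ ω, y ω ^ 2 ∂μ := by
    rw [eq_div_iff hyp.ne', h2]
  simp only [hα, hθ, Matrix.mul_fin_two, Matrix.mulVec, dotProduct, Fin.sum_univ_two,
    Matrix.of_apply, Matrix.cons_val_zero, Matrix.cons_val_one]
  field_simp
  ring

end Regression

end Population

/-! ### Asymptotic normality of the estimator. -/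

section Errors

variable {p : ℕ}

/-- The error `w - c₀ - c₁ z 0 - … - cₚ z (p-1)` as a function of `(w, z)`. -/
noncomputable def linError (c : Fin (p + 1) → ℝ) (w : ℝ) (z : Fin p → ℝ) : ℝ :=
  w - ∑ j, c j * consOne z j

theorem measurable_linError (c : Fin (p + 1) → ℝ) :
    Measurable fun q : ℝ × (Fin p → ℝ) => linError c q.1 q.2 :=
  measurable_fst.sub (Finset.measurable_fun_sum _ fun j _ =>
    ((measurable_consOne_apply j).comp measurable_snd).const_mul _)

end Errors

theorem memLp_two_mul {Ω : Type*} [MeasurableSpace Ω] {μ : Measure Ω} {U W : Lp ℝ 2 μ}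
    (h : Integrable (fun ω => U ω ^ 2 * W ω ^ 2) μ) : MemLp (fun ω => U ω * W ω) 2 μ := by
  refine (memLp_two_iff_integrable_sq
    ((Lp.aestronglyMeasurable U).mul (Lp.aestronglyMeasurable W))).2 ?_
  simpa only [Pi.mul_apply, mul_pow] using h

/-- Asymptotic normality of the empirical squared partial correlation, when the population errors
`x`, `y` are centered and uncorrelated with the regressors `Z`. -/
theorem tendstoInDistribution_R2Hat {Ω : Type*} [MeasurableSpace Ω] {μ : Measure Ω}
    [IsProbabilityMeasure μ] {Ω' : Type*} [MeasurableSpace Ω'] {P : Measure Ω'}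
    [IsProbabilityMeasure P] {p : ℕ} {X Y x y : Lp ℝ 2 μ} {Z : Fin p → Lp ℝ 2 μ}
    {Xs Ys : ℕ → Ω' → ℝ} {Zs : ℕ → Ω' → Fin p → ℝ}
    (hcopy : ∀ i, IdentDistrib (fun ω' => (Xs i ω', Ys i ω', Zs i ω'))
      (fun ω => (X ω, Y ω, fun j => Z j ω)) P μ)
    (hindep : iIndepFun (fun i ω' => (Xs i ω', Ys i ω', Zs i ω')) P)
    {c c' : Fin (p + 1) → ℝ} {α θ : ℝ}
    (hxae : x =ᵐ[μ] fun ω => linError c (X ω) fun j => Z j ω)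
    (hyae : y =ᵐ[μ] fun ω => linError c' (Y ω) fun j => Z j ω)
    (hΓ : (secondMoment Z).det ≠ 0) (hx : x ≠ 0) (hy : y ≠ 0)
    (hox : ∀ j, ∫ ω, consOne (fun j => Z j ω) j * x ω ∂μ = 0)
    (hoy : ∀ j, ∫ ω, consOne (fun j => Z j ω) j * y ω ∂μ = 0)
    (hmx : ∀ j, MemLp (fun ω => consOne (fun j => Z j ω) j * x ω) 2 μ)
    (hmy : ∀ j, MemLp (fun ω => consOne (fun j => Z j ω) j * y ω) 2 μ)
    (h₁ : ∫ ω, x ω * (y ω - α * x ω) ∂μ = 0) (h₂ : ∫ ω, y ω * (x ω - θ * y ω) ∂μ = 0)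
    (m₁ : MemLp (fun ω => x ω * (y ω - α * x ω)) 2 μ)
    (m₂ : MemLp (fun ω => y ω * (x ω - θ * y ω)) 2 μ) :
    TendstoInDistribution
      (fun (n : ℕ) (ω' : Ω') => √n *
        (R2Hat (fun i : Fin n => Xs i ω') (fun i : Fin n => Ys i ω')
            (fun i : Fin n => Zs i ω') - α * θ))
      atTop (id : ℝ → ℝ) (fun _ => P)
      (gaussianReal 0 (((∫ ω, x ω * y ω ∂μ) / ((∫ ω, x ω ^ 2 ∂μ) * ∫ ω, y ω ^ 2 ∂μ)) ^ 2 *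
        ∫ ω, (x ω * (y ω - α * x ω) + y ω * (x ω - θ * y ω)) ^ 2 ∂μ).toNNReal) := by
  set S : ℕ → Ω' → ℝ × ℝ × (Fin p → ℝ) := fun i ω' => (Xs i ω', Ys i ω', Zs i ω') with hS
  set T : Ω → ℝ × ℝ × (Fin p → ℝ) := fun ω => (X ω, Y ω, fun j => Z j ω) with hT
  let gx : ℝ × ℝ × (Fin p → ℝ) → ℝ := fun t => linError c t.1 t.2.2
  let gy : ℝ × ℝ × (Fin p → ℝ) → ℝ := fun t => linError c' t.2.1 t.2.2
  let d : Fin (p + 1) → ℝ × ℝ × (Fin p → ℝ) → ℝ := fun j t => consOne t.2.2 j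
  have hgx : Measurable gx := (measurable_linError c).comp (measurable_fst.prodMk measurable_snd.snd)
  have hgy : Measurable gy :=
    (measurable_linError c').comp (measurable_snd.fst.prodMk measurable_snd.snd)
  have hd (j) : Measurable (d j) := (measurable_consOne_apply j).comp measurable_snd.snd
  let g₁ : ℝ × ℝ × (Fin p → ℝ) → ℝ := fun t => gx t * (gy t - α * gx t)
  let g₂ : ℝ × ℝ × (Fin p → ℝ) → ℝ := fun t => gy t * (gx t - θ * gy t)
  have hg₁ : Measurable g₁ := hgx.mul (hgy.sub (hgx.const_mul α))
  have hg₂ : Measurable g₂ := hgy.mul (hgx.sub (hgy.const_mul θ))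
  have exd (j) : (fun ω => consOne (fun j => Z j ω) j * x ω) =ᵐ[μ] fun ω => d j (T ω) * gx (T ω) := by
    filter_upwards [hxae] with ω h1
    rw [h1]
  have eyd (j) : (fun ω => consOne (fun j => Z j ω) j * y ω) =ᵐ[μ] fun ω => d j (T ω) * gy (T ω) := by
    filter_upwards [hyae] with ω h1
    rw [h1]
  have e₁ : (fun ω => x ω * (y ω - α * x ω)) =ᵐ[μ] fun ω => g₁ (T ω) := by
    filter_upwards [hxae, hyae] with ω h1 h2
    rw [h1, h2]
  have e₂ : (fun ω => y ω * (x ω - θ * y ω)) =ᵐ[μ] fun ω => g₂ (T ω) := by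
    filter_upwards [hxae, hyae] with ω h1 h2
    rw [h1, h2]
  have exx : (fun ω => x ω * x ω) =ᵐ[μ] fun ω => gx (T ω) * gx (T ω) := by
    filter_upwards [hxae] with ω h1
    rw [h1]
  have eyy : (fun ω => y ω * y ω) =ᵐ[μ] fun ω => gy (T ω) * gy (T ω) := by
    filter_upwards [hyae] with ω h1
    rw [h1]
  have exy : (fun ω => x ω * y ω) =ᵐ[μ] fun ω => gx (T ω) * gy (T ω) := by
    filter_upwards [hxae, hyae] with ω h1 h2
    rw [h1, h2]
  -- Elements of L² are defined only almost everywhere, so the law of large numbers is applied to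
  -- genuine measurable functions of the data that represent them.
  have hmean {g : ℝ × ℝ × (Fin p → ℝ) → ℝ} {f : Ω → ℝ} (hg : Measurable g)
      (hf : f =ᵐ[μ] fun ω => g (T ω)) (hi : Integrable f μ) :
      ∀ᵐ ω' ∂P, Tendsto (fun n : ℕ => (∑ i : Fin n, g (S i ω')) / n) atTop (𝓝 (∫ ω, f ω ∂μ)) := by
    rw [integral_congr_ae hf]
    exact ae_tendsto_sum_div hcopy hindep hg (hi.congr hf)
  have aG : ∀ᵐ ω' ∂P, ∀ j k, Tendsto (fun n : ℕ => (∑ i : Fin n, d j (S i ω') * d k (S i ω')) / n)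
      atTop (𝓝 (secondMoment Z j k)) := by
    refine ae_all_iff.2 fun j => ae_all_iff.2 fun k => ?_
    have hi : Integrable (fun ω => d j (T ω) * d k (T ω)) μ := by
      refine (integrable_mul_Lp (withOne Z j) (withOne Z k)).congr ?_
      filter_upwards [withOne_ae_eq Z j, withOne_ae_eq Z k] with ω h1 h2
      rw [h1, h2]
    exact hmean (g := fun t => d j t * d k t) ((hd j).mul (hd k)) (ae_eq_refl _) hi
  have axx := hmean (g := fun t => gx t * gx t) (hgx.mul hgx) exx (integrable_mul_Lp x x)
  have ayy := hmean (g := fun t => gy t * gy t) (hgy.mul hgy) eyy (integrable_mul_Lp y y)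
  have axy := hmean (g := fun t => gx t * gy t) (hgx.mul hgy) exy (integrable_mul_Lp x y)
  -- All sums that must be o(n^(3/4)) are put in one family, so that a single sequence tending to 0
  -- in probability controls them along a common subsequence.
  let G : Fin (p + 1) ⊕ Fin (p + 1) ⊕ Unit ⊕ Unit → ℝ × ℝ × (Fin p → ℝ) → ℝ :=
    Sum.elim (fun j t => d j t * gx t) (Sum.elim (fun j t => d j t * gy t)
      (Sum.elim (fun _ => g₁) fun _ => g₂))
  have hH := tendstoInMeasure_sum_sq_div hcopy hindep (g := G)
    (by
      rintro (j | j | j | j)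
      exacts [(hd j).mul hgx, (hd j).mul hgy, hg₁, hg₂])
    (by
      rintro (j | j | j | j)
      exacts [(hmx j).ae_eq (exd j), (hmy j).ae_eq (eyd j), m₁.ae_eq e₁, m₂.ae_eq e₂])
    (by
      rintro (j | j | j | j)
      exacts [(integral_congr_ae (exd j)).symm.trans (hox j),
        (integral_congr_ae (eyd j)).symm.trans (hoy j),
        (integral_congr_ae e₁).symm.trans h₁, (integral_congr_ae e₂).symm.trans h₂])
  have hpath : ∀ᵐ ω' ∂P, ∀ l ≤ (atTop : Filter ℕ),
      Tendsto (fun n : ℕ => ∑ k, (∑ i : Fin n, G k (S i ω')) ^ 2 / (n * √n)) l (𝓝 0) →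
      Tendsto (fun n : ℕ => kappaHat (fun i : Fin n => Xs i ω') (fun i : Fin n => Ys i ω')
          (fun i : Fin n => Zs i ω')) l
        (𝓝 ((∫ ω, x ω * y ω ∂μ) / ((∫ ω, x ω ^ 2 ∂μ) * ∫ ω, y ω ^ 2 ∂μ))) ∧
      Tendsto (fun n : ℕ => √n * (R2Hat (fun i : Fin n => Xs i ω') (fun i : Fin n => Ys i ω')
            (fun i : Fin n => Zs i ω') - α * θ) -
          kappaHat (fun i : Fin n => Xs i ω') (fun i : Fin n => Ys i ω')
            (fun i : Fin n => Zs i ω') *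
          ((√n)⁻¹ * ∑ i : Fin n, (g₁ (S i ω') + g₂ (S i ω')))) l (𝓝 0) := by
    filter_upwards [aG, axx, ayy, axy] with ω' bG bxx byy bxy l hl hHl
    have hk (k) : Tendsto (fun n : ℕ => (∑ i : Fin n, G k (S i ω')) ^ 2 / (n * √n)) l (𝓝 0) := by
      refine squeeze_zero (fun n => by positivity) (fun n => ?_) hHl
      exact Finset.single_le_sum (f := fun k => (∑ i : Fin n, G k (S i ω')) ^ 2 / (n * √n))
        (fun k _ => by positivity) (Finset.mem_univ k)
    simp only [sq (x _), sq (y _), Finset.sum_add_distrib]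
    have hmx' (j) : Tendsto (fun n : ℕ => (∑ i : Fin n, consOne (Zs i ω') j * gx (S i ω')) ^ 2 /
      (n * √n)) l (𝓝 0) := hk (Sum.inl j)
    have hmy' (j) : Tendsto (fun n : ℕ => (∑ i : Fin n, consOne (Zs i ω') j * gy (S i ω')) ^ 2 /
      (n * √n)) l (𝓝 0) := hk (Sum.inr (Sum.inl j))
    have hU₁ : Tendsto (fun n : ℕ => (∑ i : Fin n, gx (S i ω') * (gy (S i ω') - α * gx (S i ω'))) ^ 2
      / (n * √n)) l (𝓝 0) := hk (Sum.inr (Sum.inr (Sum.inl ())))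
    have hU₂ : Tendsto (fun n : ℕ => (∑ i : Fin n, gy (S i ω') * (gx (S i ω') - θ * gy (S i ω'))) ^ 2
      / (n * √n)) l (𝓝 0) := hk (Sum.inr (Sum.inr (Sum.inr ())))
    have hVx := (integral_sq_pos hx).ne'
    have hVy := (integral_sq_pos hy).ne'
    simp only [sq (x _), sq (y _)] at hVx hVy
    have key := tendsto_R2Hat_expansion (z := fun i => Zs i ω') (X := fun i => Xs i ω')
      (Y := fun i => Ys i ω') (x := fun i => gx (S i ω')) (y := fun i => gy (S i ω'))
      (c := c) (c' := c') (Γ := secondMoment Z) (α := α) (θ := θ)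
      (fun i => rfl) (fun i => rfl) hl hΓ hVx hVy (fun j k => (bG j k).mono_left hl)
      (bxx.mono_left hl) (byy.mono_left hl) (bxy.mono_left hl) hmx' hmy' hU₁ hU₂
    exact key
  have hSm (i) : AEMeasurable (S i) P := (hcopy i).aemeasurable_fst
  have hXm (n : ℕ) : AEMeasurable (fun ω' (i : Fin n) => Xs i ω') P :=
    aemeasurable_pi_lambda _ fun i => (hSm i).fst
  have hYm (n : ℕ) : AEMeasurable (fun ω' (i : Fin n) => Ys i ω') P :=
    aemeasurable_pi_lambda _ fun i => (hSm i).snd.fst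
  have hZm (n : ℕ) : AEMeasurable (fun ω' (i : Fin n) => Zs i ω') P :=
    aemeasurable_pi_lambda _ fun i => (hSm i).snd.snd
  have hκm (n : ℕ) : AEMeasurable (fun ω' => kappaHat (fun i : Fin n => Xs i ω')
      (fun i : Fin n => Ys i ω') (fun i : Fin n => Zs i ω')) P :=
    aemeasurable_kappaHat (hXm n) (hYm n) (hZm n)
  have hRm0 (n : ℕ) : AEMeasurable (fun ω' => R2Hat (fun i : Fin n => Xs i ω')
      (fun i : Fin n => Ys i ω') (fun i : Fin n => Zs i ω')) P :=
    aemeasurable_R2Hat (hXm n) (hYm n) (hZm n)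
  have hRm (n : ℕ) : AEMeasurable (fun ω' => √n * (R2Hat (fun i : Fin n => Xs i ω')
      (fun i : Fin n => Ys i ω') (fun i : Fin n => Zs i ω') - α * θ)) P :=
    ((hRm0 n).sub_const (α * θ)).const_mul _
  have mg₁ : MemLp (fun ω => g₁ (T ω)) 2 μ := m₁.ae_eq e₁
  have mg₂ : MemLp (fun ω => g₂ (T ω)) 2 μ := m₂.ae_eq e₂
  have mw : MemLp (fun ω => g₁ (T ω) + g₂ (T ω)) 2 μ := mg₁.add mg₂
  have hw0 : ∫ ω, g₁ (T ω) + g₂ (T ω) ∂μ = 0 := by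
    rw [integral_add (mg₁.integrable (by norm_num)) (mg₂.integrable (by norm_num)),
      ← integral_congr_ae e₁, ← integral_congr_ae e₂,
      h₁, h₂, add_zero]
  have hCLT := tendstoInDistribution_inv_sqrt_mul_sum_fin hcopy hindep
    (g := fun t => g₁ t + g₂ t) (hg₁.add hg₂) mw hw0
  have hκ0 := tendstoInMeasure_zero_of_ae_imp hH
    -- The limit κ is subtracted because the subsequence principle is stated for the limit 0.
    (F := fun n ω' => kappaHat (fun i : Fin n => Xs i ω') (fun i : Fin n => Ys i ω')
      (fun i : Fin n => Zs i ω') -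
      (∫ ω, x ω * y ω ∂μ) / ((∫ ω, x ω ^ 2 ∂μ) * ∫ ω, y ω ^ 2 ∂μ))
    (fun n => ((hκm n).sub_const _).aestronglyMeasurable)
    (hpath.mono fun ω' h l hl hHl => tendsto_sub_nhds_zero_iff.2 (h l hl hHl).1)
  have hR := tendstoInMeasure_zero_of_ae_imp hH
    (fun n => ((hRm n).sub ((hκm n).mul (hCLT.forall_aemeasurable n))).aestronglyMeasurable)
    (hpath.mono fun ω' h l hl hHl => (h l hl hHl).2)
  have hfin := tendstoInDistribution_gaussian_of_sub hCLT hκm hRm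
    (by simpa [tendstoInMeasure_iff_norm] using hκ0) hR
  convert! hfin using 2
  have hint : ∫ ω, (x ω * (y ω - α * x ω) + y ω * (x ω - θ * y ω)) ^ 2 ∂μ =
      ∫ ω, (g₁ (T ω) + g₂ (T ω)) ^ 2 ∂μ := by
    refine integral_congr_ae ?_
    filter_upwards [e₁, e₂] with ω h1 h2
    rw [h1, h2]
  rw [hint, Real.toNNReal_mul (sq_nonneg _)]
  congr 1
  exact Real.toNNReal_of_nonneg (sq_nonneg _)

end PartialCorr

theorem proposition5p1
    {Ω : Type*} [MeasurableSpace Ω] (μ : Measure Ω) [IsProbabilityMeasure μ]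
    {Ω' : Type*} [MeasurableSpace Ω'] (P : Measure Ω') [IsProbabilityMeasure P]
    (p : ℕ) (X Y : Lp ℝ 2 μ) (Z : Fin p → Lp ℝ 2 μ)
    -- independent copies of `(X, Y, Z)`
    (Xs Ys : ℕ → Ω' → ℝ) (Zs : ℕ → Ω' → Fin p → ℝ)
    (hcopy : ∀ i, IdentDistrib (fun ω' => (Xs i ω', Ys i ω', Zs i ω'))
      (fun ω => (X ω, Y ω, fun j => Z j ω)) P μ)
    (hindep : iIndepFun (fun i ω' => (Xs i ω', Ys i ω', Zs i ω')) P)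
    -- `1, X, Y, Z⁽¹⁾, …, Z⁽ᵖ⁾` are linearly independent in `L²`
    (hlin : LinearIndependent ℝ (PartialCorr.withOne (Fin.cons X (Fin.cons Y Z))))
    -- the residuals `x = X(Z)`, `y = Y(Z)`, `ε₁`, `ε₂`
    (x y ε₁ ε₂ : Lp ℝ 2 μ)
    (hx : x = PartialCorr.resid Z X) (hy : y = PartialCorr.resid Z Y)
    (hε₁ : ε₁ = PartialCorr.resid ![x] y) (hε₂ : ε₂ = PartialCorr.resid ![y] x)
    -- moment conditions
    (hZx : ∀ j, Integrable (fun ω => Z j ω ^ 2 * x ω ^ 2) μ)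
    (hZy : ∀ j, Integrable (fun ω => Z j ω ^ 2 * y ω ^ 2) μ)
    (hxε : Integrable (fun ω => x ω ^ 2 * ε₁ ω ^ 2) μ)
    (hyε : Integrable (fun ω => y ω ^ 2 * ε₂ ω ^ 2) μ) :
    -- the off-diagonal entry of `A` is well defined and the limiting variance is nonnegative
    Integrable (fun ω => x ω * y ω * ε₁ ω * ε₂ ω) μ ∧
    0 ≤ PartialCorr.limitVar x y ∧
    TendstoInDistribution
      (fun (n : ℕ) (ω' : Ω') => Real.sqrt n *
        (PartialCorr.R2Hat (fun i : Fin n => Xs i ω') (fun i : Fin n => Ys i ω')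
            (fun i : Fin n => Zs i ω') - PartialCorr.R2 x y))
      atTop (id : ℝ → ℝ) (fun _ => P)
      (gaussianReal 0 (PartialCorr.limitVar x y).toNNReal) := by
  have hpop := PartialCorr.linearIndependent_withOne hlin
  have hx_ne : x ≠ 0 := hx ▸ PartialCorr.resid_ne_zero hpop.2.1
  have hy_ne : y ≠ 0 := hy ▸ PartialCorr.resid_ne_zero hpop.2.2
  have hox (j) : ∫ ω, PartialCorr.consOne (fun j => Z j ω) j * x ω ∂μ = 0 :=
    hx ▸ PartialCorr.integral_consOne_mul_resid Z X j
  have hoy (j) : ∫ ω, PartialCorr.consOne (fun j => Z j ω) j * y ω ∂μ = 0 :=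
    hy ▸ PartialCorr.integral_consOne_mul_resid Z Y j
  -- Index 0 is the constant regressor, so orthogonality to it means being centered.
  have hx0 : ∫ ω, x ω ∂μ = 0 := by simpa [PartialCorr.consOne] using hox 0
  have hy0 : ∫ ω, y ω ∂μ = 0 := by simpa [PartialCorr.consOne] using hoy 0
  have hxae : x =ᵐ[μ] fun ω => PartialCorr.linError (PartialCorr.coef Z X) (X ω) fun j => Z j ω :=
    hx ▸ PartialCorr.resid_ae_eq Z X
  have hyae : y =ᵐ[μ] fun ω => PartialCorr.linError (PartialCorr.coef Z Y) (Y ω) fun j => Z j ω :=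
    hy ▸ PartialCorr.resid_ae_eq Z Y
  subst hε₁ hε₂
  have m₁ := PartialCorr.memLp_two_mul hxε
  have m₂ := PartialCorr.memLp_two_mul hyε
  have hlim := PartialCorr.limitVar_eq hx0 hy0 hx_ne hy_ne m₁ m₂
  refine ⟨(m₁.integrable_mul m₂).congr (ae_of_all _ fun ω => ?_), ?_, ?_⟩
  · simp only [Pi.mul_apply]
    ring
  · rw [hlim]
    exact mul_nonneg (sq_nonneg _) (integral_nonneg fun ω => sq_nonneg _)
  have hmem {U : Lp ℝ 2 μ} (hU : ∀ j, Integrable (fun ω => Z j ω ^ 2 * U ω ^ 2) μ)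
      (j : Fin (p + 1)) : MemLp (fun ω => PartialCorr.consOne (fun j => Z j ω) j * U ω) 2 μ := by
    -- For the constant regressor, membership in L² suffices; the other indices use the mixed moment
    -- conditions.
    refine Fin.cases ?_ (fun j => ?_) j
    · simpa [PartialCorr.consOne] using Lp.memLp U
    · exact PartialCorr.memLp_two_mul (hU j)
  have e₁ : (fun ω => x ω * PartialCorr.resid ![x] y ω) =ᵐ[μ]
      fun ω => x ω * (y ω - PartialCorr.regSlope x y * x ω) := by
    filter_upwards [PartialCorr.resid_single_ae_eq hx0 hy0] with ω h
    rw [h]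
  have e₂ : (fun ω => y ω * PartialCorr.resid ![y] x ω) =ᵐ[μ]
      fun ω => y ω * (x ω - PartialCorr.regSlope y x * y ω) := by
    filter_upwards [PartialCorr.resid_single_ae_eq hy0 hx0] with ω h
    rw [h]
  have h := PartialCorr.tendstoInDistribution_R2Hat hcopy hindep hxae hyae
    (PartialCorr.det_secondMoment_ne_zero hpop.1)
    hx_ne hy_ne hox hoy (hmem hZx) (hmem hZy)
    ((integral_congr_ae e₁).symm.trans PartialCorr.integral_mul_resid_single)
    ((integral_congr_ae e₂).symm.trans PartialCorr.integral_mul_resid_single)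
    (m₁.ae_eq e₁) (m₂.ae_eq e₂)
  have hint : ∫ ω, (x ω * (y ω - PartialCorr.regSlope x y * x ω) +
      y ω * (x ω - PartialCorr.regSlope y x * y ω)) ^ 2 ∂μ =
      ∫ ω, (x ω * PartialCorr.resid ![x] y ω + y ω * PartialCorr.resid ![y] x ω) ^ 2 ∂μ := by
    refine integral_congr_ae ?_
    filter_upwards [e₁, e₂] with ω h1 h2
    rw [← h1, ← h2]
  rw [hint, ← hlim] at h
  rw [PartialCorr.R2_eq hx0 hy0 hy_ne]
  exact h
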